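/- Let $\mathcal{R}ing(0,+,*,<)+MOD+M$ be the logic whose sentences are built from the constant symbol $0$, the binary function symbols $+,*$ and the binary relation symbols $=,<$ with the Boolean connectives, the first-order quantifiers, the modular quantifiers $\exists^{(r,q)}z$ (for integers $0\le r<q$) and the majority quantifier $Mz$. Sentences are interpreted in the residue class rings $\mathbb{Z}_m$, $m>0$, with universe $\{0,1,\ldots,m-1\}$, addition and multiplication modulo $m$, and the natural order $<$ of $\{0,\ldots,m-1\}$; $\exists^{(r,q)}z\,\phi$ means that the number of $z\in\mathbb{Z}_m$ satisfying $\phi$ is congruent to $r$ modulo $q$, and $Mz\,\phi$ means that more than half of the elements $z\in\mathbb{Z}_m$ satisfy $\phi$. The prime spectrum of a sentence $\theta$ is $Sp(\theta)=\{p \text{ prime} : \mathbb{Z}_p\models\theta\}$. For a set $S$ of primes put $\pi_S(x)=|\{p\in S: p\le x\}|$, and let $\pi(x)$ be the number of primes $p\le x$; $S$ has exponential density if $$\liminf_{x\to\infty}\frac{\log \pi_S(x)}{\log\pi(x)}=\limsup_{x\to\infty}\frac{\log \pi_S(x)}{\log\pi(x)}$$ (for $S=\emptyset$ the density is $0$ by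 convention). **Theorem.** There is a sentence $\theta$ of $\mathcal{R}ing(0,+,*,<)+MOD+M$ whose prime spectrum $Sp(\theta)$ has no exponential density. More precisely, for every prime $q\ge 7$ there is a sentence $\theta$ of this logic such that $$Sp(\theta)=\{p \text{ prime} : q^{q^{2n}}<p<q^{q^{2n+1}} \text{ for some integer } n\ge 1\},$$ and this set has no exponential density. -/

import Mathlib

open Filter

namespace RingLogic

/-- Terms over the constant symbol `0` and the binary function symbols `+`, `*`, with variables
indexed by `Fin n`. -/
inductive Term (n : ℕ) : Type
  | var (i : Fin n) : Term n
  | zero : Term n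
  | add (s t : Term n) : Term n
  | mul (s t : Term n) : Term n

/-- Formulas of Ring(0,+,*,<)+MOD+M whose free variables are indexed by `Fin n`.  A quantifier
binds the variable with index `0` of its body; the variable with index `i + 1` of the body is the
variable with index `i` outside.  The modular quantifiers are indexed by a modulus `q` and a
residue `r` with `0 ≤ r < q` (hence `q > 0`). -/
inductive Formula : ℕ → Type
  | eq {n : ℕ} (s t : Term n) : Formula n
  | lt {n : ℕ} (s t : Term n) : Formula n
  | neg {n : ℕ} (φ : Formula n) : Formula n
  | conj {n : ℕ} (φ ψ : Formula n) : Formula n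
  | ex {n : ℕ} (φ : Formula (n + 1)) : Formula n
  | modular {n : ℕ} (q : ℕ) (r : Fin q) (φ : Formula (n + 1)) : Formula n
  | majority {n : ℕ} (φ : Formula (n + 1)) : Formula n

/-- A sentence is a formula without free variables. -/
abbrev Sentence : Type := Formula 0

/-- The value of a term in the ring of residue classes modulo `m`. -/
def Term.eval {m n : ℕ} (v : Fin n → ZMod m) : Term n → ZMod m
  | .var i => v i
  | .zero => 0
  | .add s t => s.eval v + t.eval v
  | .mul s t => s.eval v * t.eval v

/-- Satisfaction in the ring `ZMod m`, for `m > 0`, where `<` is the natural order of the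
representatives `0, 1, …, m - 1`.  The majority quantifier says "for more than half of the `m`
possible values". -/
def Formula.Realize {m : ℕ} : {n : ℕ} → Formula n → (Fin n → ZMod m) → Prop
  | _, .eq s t, v => s.eval v = t.eval v
  | _, .lt s t, v => (s.eval v).val < (t.eval v).val
  | _, .neg φ, v => ¬ φ.Realize v
  | _, .conj φ ψ, v => φ.Realize v ∧ ψ.Realize v
  | _, .ex φ, v => ∃ z : ZMod m, φ.Realize (Fin.cons z v : Fin (_ + 1) → ZMod m)
  | _, .modular q r φ, v =>
      {z : ZMod m | φ.Realize (Fin.cons z v : Fin (_ + 1) → ZMod m)}.ncard ≡ (r : ℕ) [MOD q]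
  | _, .majority φ, v =>
      m < 2 * {z : ZMod m | φ.Realize (Fin.cons z v : Fin (_ + 1) → ZMod m)}.ncard

/-- The sentence `σ` holds in the ring of residue classes modulo `m`. -/
def Sentence.Holds (σ : Sentence) (m : ℕ) : Prop :=
  Formula.Realize (m := m) σ Fin.elim0

/-- The prime spectrum of a sentence: the primes `p` such that the sentence holds modulo `p`. -/
def primeSpectrum (σ : Sentence) : Set ℕ :=
  {p | p.Prime ∧ Sentence.Holds σ p}

end RingLogic

namespace PrimeDensity

/-- The number of elements of `S` (a set of primes) that are at most `x`. -/
noncomputable def countUpTo (S : Set ℕ) (x : ℕ) : ℕ :=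
  {p | p ∈ S ∧ p ≤ x}.ncard

/-- The quotient `h(π_S(x)) / h(π(x))`. -/
noncomputable def ratio (h : ℝ → ℝ) (S : Set ℕ) (x : ℕ) : ℝ :=
  h (countUpTo S x) / h (Nat.primeCounting x)

/-- The lower `h`-density of a set `S` of primes. -/
noncomputable def lowerDensity (h : ℝ → ℝ) (S : Set ℕ) : EReal :=
  liminf (fun x : ℕ => (ratio h S x : EReal)) atTop

/-- The upper `h`-density of a set `S` of primes. -/
noncomputable def upperDensity (h : ℝ → ℝ) (S : Set ℕ) : EReal :=
  limsup (fun x : ℕ => (ratio h S x : EReal)) atTop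

/-- `S` has `h`-density if its lower and upper `h`-densities agree. -/
def HasDensity (h : ℝ → ℝ) (S : Set ℕ) : Prop :=
  lowerDensity h S = upperDensity h S

/-- Exponential density is `h`-density for `h = log`. -/
def HasExponentialDensity (S : Set ℕ) : Prop :=
  HasDensity Real.log S

/-- The alternating set of primes of a sequence `s 1 < s 2 < …`: the primes in
`(s 2, s 3) ∪ (s 4, s 5) ∪ …`. -/
def alternatingPrimes (s : ℕ → ℕ) : Set ℕ :=
  {p | p.Prime ∧ ∃ n : ℕ, 1 ≤ n ∧ s (2 * n) < p ∧ p < s (2 * n + 1)}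

end PrimeDensity

/-! Let `N = Nat.log q (p - 1)`. The order detects wraparound in `ZMod p`: a product `d * e` is the
true integer product when multiplication by `d` is increasing on `[0, e]`. Divisibility below `p` is
therefore expressible, and with it the `N` powers `q ^ i` with `q * q ^ i < p` (`isSmallPow_iff`).
The majority quantifier then compares a power with `N`. Padding these powers with `0` and a top
interval whose length drops by one as `x` grows by one gives more than `p / 2` elements exactly when
`x ≤ N` (`isCountedPow_iff`). The powers that pass are `q ^ 0, …, q ^ J` with `J = Nat.log q N`. A
parity quantifier on their number `J + 1` says that `J` is even, and asking for two of them excludes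
`J = 0`. Since `J = k` means that `p` lies between `q ^ q ^ k` and `q ^ q ^ (k + 1)`, this is the
required spectrum. For the density, `π x ≥ √x` suffices. At the left end `x` of a block at most `x ^
(1 / q)` primes are counted, so the log ratio is at most `2 / q`; at the right end at least `x ^ (1
/ 3)` are, so it is at least `1 / 3`. These bounds separate once `q > 6`. -/

namespace RingLogic

/-! ### Closure properties of definable relations. -/

/-- The term with all variable indices increased by one. -/
def Term.shift {n : ℕ} : Term n → Term (n + 1)
  | .var i => .var i.succ
  | .zero => .zero
  | .add s t => .add s.shift t.shift
  | .mul s t => .mul s.shift t.shift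

theorem Term.eval_shift {m n : ℕ} (w : Fin (n + 1) → ZMod m) (t : Term n) :
    t.shift.eval w = t.eval (Fin.tail w) := by
  induction t with
  | var i => rfl
  | zero => rfl
  | add s t hs ht => simp only [Term.shift, Term.eval, hs, ht]
  | mul s t hs ht => simp only [Term.shift, Term.eval, hs, ht]

/-- A family of functions on the rings `ZMod m` given by a single term. -/
def TermDefinable {n : ℕ} (f : ∀ m, (Fin n → ZMod m) → ZMod m) : Prop :=
  ∃ t : Term n, ∀ m v, t.eval v = f m v

/-- A family of relations on the rings `ZMod m` given by a single formula. -/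
def Definable {n : ℕ} (P : ∀ m, (Fin n → ZMod m) → Prop) : Prop :=
  ∃ φ : Formula n, ∀ m v, φ.Realize v ↔ P m v

namespace TermDefinable

variable {n : ℕ} {f g : ∀ m, (Fin n → ZMod m) → ZMod m}

theorem var (i : Fin n) : TermDefinable fun _ v => v i :=
  ⟨.var i, fun _ _ => rfl⟩

theorem zero : TermDefinable (n := n) fun _ _ => 0 :=
  ⟨.zero, fun _ _ => rfl⟩

theorem add (hf : TermDefinable f) (hg : TermDefinable g) :
    TermDefinable fun m v => f m v + g m v := by
  obtain ⟨s, hs⟩ := hf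
  obtain ⟨t, ht⟩ := hg
  exact ⟨.add s t, fun m v => by simp only [Term.eval, hs, ht]⟩

theorem mul (hf : TermDefinable f) (hg : TermDefinable g) :
    TermDefinable fun m v => f m v * g m v := by
  obtain ⟨s, hs⟩ := hf
  obtain ⟨t, ht⟩ := hg
  exact ⟨.mul s t, fun m v => by simp only [Term.eval, hs, ht]⟩

theorem tail (hf : TermDefinable f) :
    TermDefinable (n := n + 1) fun m w => f m (Fin.tail w) := by
  obtain ⟨t, ht⟩ := hf
  exact ⟨t.shift, fun m w => by rw [Term.eval_shift, ht]⟩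

theorem nsmul (k : ℕ) (hf : TermDefinable f) : TermDefinable fun m v => k • f m v := by
  induction k with
  | zero => simpa only [zero_smul] using zero
  | succ k ih => simpa only [succ_nsmul] using ih.add hf

end TermDefinable

namespace Definable

variable {n : ℕ} {f g : ∀ m, (Fin n → ZMod m) → ZMod m}
  {P Q : ∀ m, (Fin n → ZMod m) → Prop} {R : ∀ m, (Fin n → ZMod m) → ZMod m → Prop}

theorem eq (hf : TermDefinable f) (hg : TermDefinable g) :
    Definable fun m v => f m v = g m v := by
  obtain ⟨s, hs⟩ := hf
  obtain ⟨t, ht⟩ := hg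
  exact ⟨.eq s t, fun m v => by simp only [Formula.Realize, hs, ht]⟩

theorem lt (hf : TermDefinable f) (hg : TermDefinable g) :
    Definable fun m v => (f m v).val < (g m v).val := by
  obtain ⟨s, hs⟩ := hf
  obtain ⟨t, ht⟩ := hg
  exact ⟨.lt s t, fun m v => by simp only [Formula.Realize, hs, ht]⟩

theorem not (hP : Definable P) : Definable fun m v => ¬ P m v := by
  obtain ⟨φ, hφ⟩ := hP
  exact ⟨.neg φ, fun m v => by simp only [Formula.Realize, hφ]⟩

theorem and (hP : Definable P) (hQ : Definable Q) : Definable fun m v => P m v ∧ Q m v := by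
  obtain ⟨φ, hφ⟩ := hP
  obtain ⟨ψ, hψ⟩ := hQ
  exact ⟨.conj φ ψ, fun m v => by simp only [Formula.Realize, hφ, hψ]⟩

theorem or (hP : Definable P) (hQ : Definable Q) : Definable fun m v => P m v ∨ Q m v := by
  simpa only [or_iff_not_and_not] using (hP.not.and hQ.not).not

theorem imp (hP : Definable P) (hQ : Definable Q) : Definable fun m v => P m v → Q m v := by
  simpa only [imp_iff_not_or] using hP.not.or hQ

theorem le (hf : TermDefinable f) (hg : TermDefinable g) :
    Definable fun m v => (f m v).val ≤ (g m v).val := by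
  simpa only [not_lt] using (lt hg hf).not

theorem ex (hR : Definable (n := n + 1) fun m w => R m (Fin.tail w) (w 0)) :
    Definable fun m v => ∃ z, R m v z := by
  obtain ⟨φ, hφ⟩ := hR
  exact ⟨.ex φ, fun m v => by simp only [Formula.Realize, hφ, Fin.tail_cons, Fin.cons_zero]⟩

theorem all (hR : Definable (n := n + 1) fun m w => R m (Fin.tail w) (w 0)) :
    Definable fun m v => ∀ z, R m v z := by
  simpa only [not_exists, not_not] using (ex (R := fun m v z => ¬ R m v z) hR.not).not

theorem modular (q : ℕ) (r : Fin q)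
    (hR : Definable (n := n + 1) fun m w => R m (Fin.tail w) (w 0)) :
    Definable fun m v => {z | R m v z}.ncard ≡ r [MOD q] := by
  obtain ⟨φ, hφ⟩ := hR
  exact ⟨.modular q r φ, fun m v => by
    simp only [Formula.Realize, hφ, Fin.tail_cons, Fin.cons_zero]⟩

theorem majority (hR : Definable (n := n + 1) fun m w => R m (Fin.tail w) (w 0)) :
    Definable fun m v => m < 2 * {z | R m v z}.ncard := by
  obtain ⟨φ, hφ⟩ := hR
  exact ⟨.majority φ, fun m v => by
    simp only [Formula.Realize, hφ, Fin.tail_cons, Fin.cons_zero]⟩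

theorem forall_lt {P : ℕ → ∀ m, (Fin n → ZMod m) → Prop} (hP : ∀ k, Definable (P k)) (q : ℕ) :
    Definable fun m v => ∀ k < q, P k m v := by
  induction q with
  | zero => exact ⟨.eq .zero .zero, fun m v => by simp [Formula.Realize]⟩
  | succ q ih => simpa only [Nat.forall_lt_succ_right] using ih.and (hP q)

end Definable

/-! ### The relations used by the sentence, and their definability. -/

/-- The multiples `0, x, …, q • x` increase, that is, `x ≠ 0` and `q * x.val < m`. -/
def NoOverflow (q : ℕ) {m : ℕ} (x : ZMod m) : Prop :=
  ∀ k < q, (k • x).val < ((k + 1) • x).val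

/-- Multiplication by `d` is strictly increasing on `[0, e]`. -/
def MulIncreasing {m : ℕ} (d e : ZMod m) : Prop :=
  ∀ a b : ZMod m, a.val < b.val → b.val ≤ e.val → (d * a).val < (d * b).val

/-- `q * x.val < m` and every divisor of `x.val` other than `1` is a multiple of `q`. -/
def IsSmallPow (q : ℕ) {m : ℕ} (x : ZMod m) : Prop :=
  NoOverflow q x ∧ ∀ d e : ZMod m, MulIncreasing d e → d * e = x → d * d ≠ d →
    ∃ f, NoOverflow q f ∧ q • f = d

/-- For odd `m`, the relation `m / 2 + x.val < z.val`. -/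
def UpperShift {m : ℕ} (x z : ZMod m) : Prop :=
  ∃ w : ZMod m, (w + w).val < w.val ∧ w.val ≤ (w + x).val ∧ w + x = z

/-- `x` is a small power of `q` whose value is at most the number of small powers of `q`. -/
def IsCountedPow (q : ℕ) {m : ℕ} (x : ZMod m) : Prop :=
  IsSmallPow q x ∧ m < 2 * {z : ZMod m | z = 0 ∨ IsSmallPow q z ∨ UpperShift x z}.ncard

section Definability

variable {n : ℕ} {f g : ∀ m, (Fin n → ZMod m) → ZMod m}

theorem definable_noOverflow (q : ℕ) (hf : TermDefinable f) :
    Definable fun m v => NoOverflow q (f m v) :=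
  .forall_lt (fun k => .lt (hf.nsmul k) (hf.nsmul (k + 1))) q

theorem definable_mulIncreasing (hf : TermDefinable f) (hg : TermDefinable g) :
    Definable fun m v => MulIncreasing (f m v) (g m v) :=
  .all <| .all <| .imp (.lt (.var 1) (.var 0)) <| .imp (.le (.var 0) hg.tail.tail) <|
    .lt (hf.tail.tail.mul (.var 1)) (hf.tail.tail.mul (.var 0))

theorem definable_isSmallPow (q : ℕ) (hf : TermDefinable f) :
    Definable fun m v => IsSmallPow q (f m v) :=
  .and (definable_noOverflow q hf) <| .all <| .all <|
    .imp (definable_mulIncreasing (.var 1) (.var 0)) <|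
    .imp (.eq (.mul (.var 1) (.var 0)) hf.tail.tail) <|
    .imp (.not (.eq (.mul (.var 1) (.var 1)) (.var 1))) <|
    .ex <| .and (definable_noOverflow q (.var 0)) (.eq (.nsmul q (.var 0)) (.var 2))

theorem definable_upperShift (hf : TermDefinable f) (hg : TermDefinable g) :
    Definable fun m v => UpperShift (f m v) (g m v) :=
  .ex <| .and (.lt (.add (.var 0) (.var 0)) (.var 0)) <|
    .and (.le (.var 0) (.add (.var 0) hf.tail)) (.eq (.add (.var 0) hf.tail) hg.tail)

theorem definable_isCountedPow (q : ℕ) (hf : TermDefinable f) :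
    Definable fun m v => IsCountedPow q (f m v) :=
  .and (definable_isSmallPow q hf) <| .majority <| .or (.eq (.var 0) .zero) <|
    .or (definable_isSmallPow q (.var 0)) (definable_upperShift hf.tail (.var 0))

end Definability

/-- A sentence saying that the number of counted powers of `q` is odd and at least two. -/
theorem exists_sentence (q : ℕ) : ∃ θ : Sentence, ∀ m, θ.Holds m ↔
    {x : ZMod m | IsCountedPow q x}.ncard ≡ 1 [MOD 2] ∧
      ∃ x y : ZMod m, IsCountedPow q x ∧ IsCountedPow q y ∧ x.val < y.val := by
  have h : Definable (n := 0) fun m _ => {x : ZMod m | IsCountedPow q x}.ncard ≡ 1 [MOD 2] ∧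
      ∃ x y : ZMod m, IsCountedPow q x ∧ IsCountedPow q y ∧ x.val < y.val :=
    .and (.modular 2 1 (definable_isCountedPow q (.var 0))) <| .ex <| .ex <|
      .and (definable_isCountedPow q (.var 1)) <|
      .and (definable_isCountedPow q (.var 0)) (.lt (.var 1) (.var 0))
  obtain ⟨θ, hθ⟩ := h
  exact ⟨θ, fun m => hθ m _⟩

end RingLogic

/-! ### Meaning of these relations modulo a prime. -/

namespace RingLogic

variable {p q : ℕ}

/-- Adding `d` either raises the representative by `d.val` or wraps around and lowers it by `p -
d.val > 0`, so monotonicity rules out every wrap. -/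
theorem val_mul_natCast_of_increasing [Fact p.Prime] {d : ZMod p} {n : ℕ}
    (h : ∀ k < n, (d * (k : ZMod p)).val < (d * ((k + 1 : ℕ) : ZMod p)).val) :
    ∀ k ≤ n, (d * (k : ZMod p)).val = d.val * k := by
  intro k
  induction k with
  | zero => simp
  | succ k ih =>
    intro hk
    have h1 := ih (by omega)
    have h2 := h k (by omega)
    have h3 : d * ((k + 1 : ℕ) : ZMod p) = d * k + d := by push_cast; ring
    rw [h3] at h2 ⊢
    rcases lt_or_ge ((d * (k : ZMod p)).val + d.val) p with h4 | h4
    · rw [ZMod.val_add_of_lt h4, h1]; ring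
    · rw [ZMod.val_add_of_le h4] at h2
      have := d.val_lt
      omega

theorem val_nsmul_of_lt [Fact p.Prime] {x : ZMod p} {k : ℕ} (h : k * x.val < p) :
    (k • x).val = k * x.val := by
  conv_lhs => rw [← ZMod.natCast_zmod_val x, nsmul_eq_mul, ← Nat.cast_mul]
  exact ZMod.val_cast_of_lt h

theorem noOverflow_iff [Fact p.Prime] (hq : 0 < q) {x : ZMod p} :
    NoOverflow q x ↔ 0 < x.val ∧ q * x.val < p := by
  constructor
  · intro h
    have h0 := h 0 hq
    simp only [zero_smul, zero_add, one_smul, ZMod.val_zero] at h0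
    refine ⟨h0, ?_⟩
    have := val_mul_natCast_of_increasing (d := x) (n := q)
      (fun k hk => by simpa only [nsmul_eq_mul, mul_comm] using h k hk) q le_rfl
    rw [mul_comm, ← this]
    exact ZMod.val_lt _
  · rintro ⟨h0, h1⟩ k hk
    have h2 : (k + 1) * x.val ≤ q * x.val := Nat.mul_le_mul_right _ hk
    have h3 : k * x.val < (k + 1) * x.val := by nlinarith
    rw [val_nsmul_of_lt (by omega), val_nsmul_of_lt (by omega)]
    exact h3

theorem val_mul_of_mulIncreasing [Fact p.Prime] {d e : ZMod p} (h : MulIncreasing d e) :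
    (d * e).val = d.val * e.val := by
  have := val_mul_natCast_of_increasing (d := d) (n := e.val) (fun k hk => by
    have he := e.val_lt
    apply h <;> rw [ZMod.val_cast_of_lt (by omega)]
    · rw [ZMod.val_cast_of_lt (by omega)]; omega
    · omega) e.val le_rfl
  rwa [ZMod.natCast_zmod_val] at this

theorem mulIncreasing_of_lt [Fact p.Prime] {d e : ZMod p} (hd : 0 < d.val)
    (h : d.val * e.val < p) : MulIncreasing d e := by
  intro a b hab hbe
  have h1 : d.val * b.val ≤ d.val * e.val := Nat.mul_le_mul_left _ hbe
  have h2 : d.val * a.val < d.val * b.val := Nat.mul_lt_mul_of_pos_left hab hd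
  rw [ZMod.val_mul_of_lt (by omega), ZMod.val_mul_of_lt (by omega)]
  exact h2

theorem mul_self_ne_iff [Fact p.Prime] {d : ZMod p} : d * d ≠ d ↔ d.val ≠ 0 ∧ d.val ≠ 1 := by
  have h1 : d.val = 1 ↔ d = 1 := by
    conv_lhs => rw [← ZMod.val_one p]
    exact (ZMod.val_injective p).eq_iff
  rw [← not_or, not_iff_not, ZMod.val_eq_zero, h1]
  exact IsIdempotentElem.iff_eq_zero_or_one

theorem isSmallPow_iff [Fact p.Prime] (hq : q.Prime) {x : ZMod p} :
    IsSmallPow q x ↔ ∃ i < Nat.log q (p - 1), x.val = q ^ i := by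
  have hp := (Fact.out : p.Prime).two_le
  -- The bound `q ^ (i + 1) ≤ p - 1` is the absence of overflow for `q • x` at `x = q ^ i`.
  have hlog : ∀ i, i < Nat.log q (p - 1) ↔ q * q ^ i < p := fun i => by
    rw [← Nat.succ_le_iff, Nat.le_log_iff_pow_le hq.one_lt (by omega), pow_succ, mul_comm]
    omega
  simp only [hlog, IsSmallPow, noOverflow_iff hq.pos, mul_self_ne_iff]
  constructor
  · rintro ⟨⟨hx0, hxp⟩, h⟩
    -- A number whose only prime divisor is `q` is a power of `q`, so the divisor condition is
    -- needed only for prime `d`.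
    have hpow := Nat.eq_prime_pow_of_unique_prime_dvd (p := q) hx0.ne' (fun {d} hd hdx => by
      obtain ⟨e, he⟩ := hdx
      have hxlt := x.val_lt
      have he0 : 0 < e := Nat.pos_of_ne_zero fun h => by simp only [h, mul_zero] at he; omega
      have hdv : (d : ZMod p).val = d := ZMod.val_cast_of_lt
        ((Nat.le_mul_of_pos_right d he0).trans_lt (he ▸ hxlt))
      have hev : (e : ZMod p).val = e := ZMod.val_cast_of_lt
        ((Nat.le_mul_of_pos_left e hd.pos).trans_lt (he ▸ hxlt))
      obtain ⟨f, ⟨-, hf⟩, hfd⟩ := h d e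
        (mulIncreasing_of_lt (by rw [hdv]; exact hd.pos) (by rw [hdv, hev]; omega))
        (by rw [← Nat.cast_mul, ← he, ZMod.natCast_zmod_val])
        (by rw [hdv]; exact ⟨hd.ne_zero, hd.ne_one⟩)
      have h2 := val_nsmul_of_lt hf
      rw [hfd, hdv] at h2
      exact ((Nat.prime_dvd_prime_iff_eq hq hd).1 (Dvd.intro _ h2.symm)).symm)
    exact ⟨_, hpow ▸ hxp, hpow⟩
  · rintro ⟨i, hi, hx⟩
    refine ⟨⟨hx ▸ pow_pos hq.pos i, hx ▸ hi⟩, ?_⟩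
    rintro d e hde hdx ⟨hd0, hd1⟩
    have h1 := val_mul_of_mulIncreasing hde
    rw [hdx, hx] at h1
    obtain ⟨j, -, hj⟩ := (Nat.dvd_prime_pow hq).1 (Dvd.intro _ h1.symm)
    obtain ⟨j, rfl⟩ : ∃ k, j = k + 1 := Nat.exists_eq_succ_of_ne_zero fun h => hd1 (by simp [hj, h])
    have hlt : q * q ^ j < p := by
      rw [mul_comm, ← pow_succ, ← hj]; exact d.val_lt
    have hf : ((q ^ j : ℕ) : ZMod p).val = q ^ j :=
      ZMod.val_cast_of_lt ((Nat.le_mul_of_pos_left _ hq.pos).trans_lt hlt)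
    refine ⟨(q ^ j : ℕ), ⟨by rw [hf]; exact pow_pos hq.pos j, by rwa [hf]⟩, ?_⟩
    apply ZMod.val_injective p
    rw [val_nsmul_of_lt (by rwa [hf]), hf, hj, pow_succ, mul_comm]

/-- For odd `p`, doubling lowers `w` exactly when `w` is in the upper half; `w ≤ w + x` then forbids
wrapping in the shift by `x`. -/
theorem upperShift_iff [Fact p.Prime] (hp : p ≠ 2) {x z : ZMod p} :
    UpperShift x z ↔ p / 2 + 1 + x.val ≤ z.val := by
  have hodd := (Fact.out : p.Prime).eq_two_or_odd.resolve_left hp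
  have half : ∀ w : ZMod p, (w + w).val < w.val ↔ p / 2 < w.val := fun w => by
    have := w.val_lt
    rcases lt_or_ge (w.val + w.val) p with h | h
    · rw [ZMod.val_add_of_lt h]; omega
    · rw [ZMod.val_add_of_le h]; omega
  simp only [UpperShift, half]
  constructor
  · rintro ⟨w, h1, h2, rfl⟩
    rcases lt_or_ge (w.val + x.val) p with h | h
    · rw [ZMod.val_add_of_lt h]; omega
    · rw [ZMod.val_add_of_le h] at h2
      have := x.val_lt
      omega
  · intro h
    have hz := z.val_lt
    have hw : (z - x).val = z.val - x.val := ZMod.val_sub (by omega)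
    refine ⟨z - x, by omega, ?_, sub_add_cancel z x⟩
    rw [sub_add_cancel]; omega

theorem ncard_eq_card_of_val [NeZero p] {A : Set (ZMod p)} (s : Finset ℕ)
    (hs : ∀ n ∈ s, n < p) (h : ∀ z : ZMod p, z ∈ A ↔ z.val ∈ s) : A.ncard = s.card := by
  rw [← Set.ncard_image_of_injective A (ZMod.val_injective p), ← Set.ncard_coe_finset]
  congr 1
  ext n
  simp only [Set.mem_image, Finset.mem_coe]
  constructor
  · rintro ⟨z, hz, rfl⟩
    exact (h z).1 hz
  · intro hn
    have := ZMod.val_cast_of_lt (hs n hn)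
    exact ⟨n, (h _).2 (by rwa [this]), this⟩

theorem isCountedPow_iff [Fact p.Prime] (hq : q.Prime) {x : ZMod p} :
    IsCountedPow q x ↔ ∃ i < Nat.log q (p - 1), q ^ i ≤ Nat.log q (p - 1) ∧ x.val = q ^ i := by
  have hp := (Fact.out : p.Prime)
  set N := Nat.log q (p - 1) with hN
  suffices H : IsSmallPow q x →
      (p < 2 * {z : ZMod p | z = 0 ∨ IsSmallPow q z ∨ UpperShift x z}.ncard ↔ x.val ≤ N) by
    unfold IsCountedPow
    constructor
    · rintro ⟨h1, h2⟩
      obtain ⟨i, hi, hx⟩ := (isSmallPow_iff hq).1 h1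
      exact ⟨i, hi, hx ▸ (H h1).1 h2, hx⟩
    · rintro ⟨i, hi, hiN, hx⟩
      have h1 := (isSmallPow_iff hq).2 ⟨i, hi, hx⟩
      exact ⟨h1, (H h1).2 (hx ▸ hiN)⟩
  intro hx
  -- Small powers lie in the lower half, hence are disjoint from the top interval.
  have hpow : ∀ i < N, 2 * q ^ i < p := fun i hi => by
    have h1 : q ^ (i + 1) ≤ p - 1 :=
      (Nat.le_log_iff_pow_le hq.one_lt (by have := hp.two_le; omega)).1 hi
    have h2 : 2 * q ^ i ≤ q ^ (i + 1) := by
      rw [pow_succ, mul_comm]; exact Nat.mul_le_mul_left _ hq.two_le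
    have := hp.two_le
    omega
  obtain ⟨i, hi, hxi⟩ := (isSmallPow_iff hq).1 hx
  have h2x : 2 * x.val < p := hxi ▸ hpow i hi
  have hp2 : p ≠ 2 := by
    have := pow_pos hq.pos i
    omega
  have hodd := hp.eq_two_or_odd.resolve_left hp2
  have hcard : {z : ZMod p | z = 0 ∨ IsSmallPow q z ∨ UpperShift x z}.ncard =
      1 + (N + (p - (p / 2 + 1 + x.val))) := by
    have hd1 : Disjoint ((Finset.range N).image (q ^ ·)) (Finset.Ico (p / 2 + 1 + x.val) p) := by
      rw [Finset.disjoint_left]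
      intro n hn
      obtain ⟨j, hj, rfl⟩ := Finset.mem_image.1 hn
      have := hpow j (Finset.mem_range.1 hj)
      rw [Finset.mem_Ico]
      omega
    have hd2 : Disjoint {0}
        ((Finset.range N).image (q ^ ·) ∪ Finset.Ico (p / 2 + 1 + x.val) p) := by
      rw [Finset.disjoint_singleton_left]
      simp only [Finset.mem_union, Finset.mem_image, Finset.mem_Ico]
      rintro (⟨j, -, hj⟩ | h)
      · exact (pow_pos hq.pos j).ne' hj
      · omega
    rw [ncard_eq_card_of_val
        ({0} ∪ ((Finset.range N).image (q ^ ·) ∪ Finset.Ico (p / 2 + 1 + x.val) p)),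
      Finset.card_union_of_disjoint hd2, Finset.card_union_of_disjoint hd1,
      Finset.card_singleton, Nat.card_Ico,
      Finset.card_image_of_injective _ (Nat.pow_right_injective hq.two_le), Finset.card_range]
    · intro n hn
      simp only [Finset.mem_union, Finset.mem_singleton, Finset.mem_image, Finset.mem_range,
        Finset.mem_Ico] at hn
      rcases hn with rfl | ⟨j, hj, rfl⟩ | hn
      · exact hp.pos
      · have := hpow j hj; omega
      · exact hn.2
    · intro z
      simp only [Set.mem_ofPred_eq, Finset.mem_union, Finset.mem_singleton, Finset.mem_image,
        Finset.mem_range, Finset.mem_Ico, isSmallPow_iff hq, upperShift_iff hp2, z.val_lt, and_true,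
        ZMod.val_eq_zero, eq_comm (b := z.val), ← hN]
  -- For odd `p` the cardinality is `(p + 1) / 2 + N - x.val`; the padding by `0` is what makes the
  -- threshold exactly `x.val ≤ N`.
  rw [hcard]
  omega

theorem isCountedPow_iff_le_log [Fact p.Prime] (hq : q.Prime) (hN : Nat.log q (p - 1) ≠ 0)
    {x : ZMod p} :
    IsCountedPow q x ↔ ∃ i ≤ Nat.log q (Nat.log q (p - 1)), x.val = q ^ i := by
  rw [isCountedPow_iff hq]
  refine exists_congr fun i => ?_
  rw [Nat.le_log_iff_pow_le hq.one_lt hN, ← and_assoc]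
  refine and_congr_left fun _ => and_iff_right_of_imp fun h => ?_
  exact (Nat.lt_pow_self hq.one_lt).trans_le h

theorem counting_condition_iff [Fact p.Prime] (hq : q.Prime) :
    ({x : ZMod p | IsCountedPow q x}.ncard ≡ 1 [MOD 2] ∧
      ∃ x y : ZMod p, IsCountedPow q x ∧ IsCountedPow q y ∧ x.val < y.val) ↔
    ∃ n, 1 ≤ n ∧ Nat.log q (Nat.log q (p - 1)) = 2 * n := by
  -- When `N = 0` no power is counted, and the default `Nat.log q 0 = 0` contradicts `1 ≤ n`.
  rcases eq_or_ne (Nat.log q (p - 1)) 0 with hN | hN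
  · simp only [isCountedPow_iff hq, hN, not_lt_zero, false_and, exists_false, and_false,
      Nat.log_zero_right, false_iff]
    rintro ⟨n, hn, h⟩
    omega
  set J := Nat.log q (Nat.log q (p - 1)) with hJ
  have hlt : ∀ i ≤ J, q ^ i < p := fun i hi => by
    have hp := (Fact.out : p.Prime).two_le
    have h1 : q ^ i ≤ Nat.log q (p - 1) := (Nat.le_log_iff_pow_le hq.one_lt hN).1 hi
    have h2 := Nat.log_lt_self q (x := p - 1) (by omega)
    omega
  have hcard : {x : ZMod p | IsCountedPow q x}.ncard = J + 1 := by
    rw [ncard_eq_card_of_val ((Finset.range (J + 1)).image (q ^ ·)),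
      Finset.card_image_of_injective _ (Nat.pow_right_injective hq.two_le), Finset.card_range]
    · intro n hn
      obtain ⟨i, hi, rfl⟩ := Finset.mem_image.1 hn
      exact hlt i (by have := Finset.mem_range.1 hi; omega)
    · intro z
      simp only [Set.mem_ofPred_eq, isCountedPow_iff_le_log hq hN, Finset.mem_image,
        Finset.mem_range, Nat.lt_succ_iff, eq_comm (b := z.val), ← hJ]
  rw [hcard]
  simp only [isCountedPow_iff_le_log hq hN, ← hJ]
  constructor
  · rintro ⟨h1, x, y, ⟨i, hi, hx⟩, ⟨j, hj, hy⟩, hxy⟩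
    rw [hx, hy, Nat.pow_lt_pow_iff_right hq.one_lt] at hxy
    rw [Nat.ModEq] at h1
    exact ⟨J / 2, by omega, by omega⟩
  · rintro ⟨n, hn, h⟩
    refine ⟨by rw [Nat.ModEq]; omega, (q ^ 0 : ℕ), (q ^ 1 : ℕ), ?_⟩
    have h0 := ZMod.val_cast_of_lt (hlt 0 (by omega))
    have h1 := ZMod.val_cast_of_lt (hlt 1 (by omega))
    exact ⟨⟨0, by omega, h0⟩, ⟨1, by omega, h1⟩, by
      rw [h0, h1]; exact Nat.pow_lt_pow_right hq.one_lt one_pos⟩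

theorem log_log_eq_iff (hp : p.Prime) (hq : q.Prime) {k : ℕ} (hk : k ≠ 0) :
    Nat.log q (Nat.log q (p - 1)) = k ↔ q ^ q ^ k < p ∧ p < q ^ q ^ (k + 1) := by
  have := hp.two_le
  -- The logarithm of `p - 1` gives only `p ≤ q ^ q ^ (k + 1)`; primality makes it strict.
  have hne : p ≠ q ^ q ^ (k + 1) := fun h =>
    Nat.Prime.not_prime_pow (hq.two_le.trans (Nat.le_self_pow k.succ_ne_zero q)) (h ▸ hp)
  rw [Nat.log_eq_iff (.inl hk), Nat.le_log_iff_pow_le hq.one_lt (by omega),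
    Nat.log_lt_iff_lt_pow hq.one_lt (by omega)]
  omega

theorem exists_sentence_primeSpectrum (hq : q.Prime) : ∃ θ : Sentence,
    primeSpectrum θ = PrimeDensity.alternatingPrimes fun n => q ^ q ^ n := by
  obtain ⟨θ, hθ⟩ := exists_sentence q
  refine ⟨θ, Set.ext fun p => and_congr_right fun hp => ?_⟩
  have := Fact.mk hp
  rw [hθ, counting_condition_iff hq]
  exact exists_congr fun n => and_congr_right fun hn => log_log_eq_iff hp hq (by omega)

end RingLogic

/-! ### Failure of exponential density. -/

namespace PrimeDensity

/-- A weak consequence of Chebyshev's lower bound, since `log n` is negligible against `√n`; the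
constant `1 / 8` leaves ample room. -/
theorem eventually_rpow_half_le_primeCounting :
    ∀ᶠ n : ℕ in atTop, (n : ℝ) ^ (1 / 2 : ℝ) ≤ Nat.primeCounting n := by
  have h1 : ∀ᶠ x : ℝ in atTop, Real.log x ≤ 1 / 8 * x ^ (1 / 2 : ℝ) := by
    filter_upwards [(isLittleO_log_rpow_atTop (r := 1 / 2) (by norm_num)).bound
      (c := 1 / 8) (by norm_num), eventually_ge_atTop 1] with x hx hx1
    rwa [Real.norm_of_nonneg (Real.log_nonneg hx1), Real.norm_of_nonneg (by positivity)] at hx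
  filter_upwards [tendsto_natCast_atTop_atTop.eventually h1, eventually_ge_atTop 2] with n hn hn2
  have hn2' : (2 : ℝ) ≤ n := by exact_mod_cast hn2
  refine le_trans ?_ (Chebyshev.pi_ge n)
  rw [le_div_iff₀ (Real.log_pos (by linarith))]
  set t := (n : ℝ) ^ (1 / 2 : ℝ) with ht
  have htt : t * t = n := by
    rw [ht, ← Real.rpow_add (by linarith)]; norm_num
  have ht1 : 1 ≤ t := Real.one_le_rpow (by linarith) (by norm_num)
  have h3 : Real.log (n + 1) ≤ Real.log n + Real.log 2 := by
    rw [← Real.log_mul (by positivity) (by norm_num)]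
    exact Real.log_le_log (by positivity) (by linarith)
  have h4 := Real.log_two_gt_d9
  have h5 := Real.log_two_lt_d9
  nlinarith [mul_le_mul_of_nonneg_left hn (by linarith : 0 ≤ t)]

theorem primeCounting_le_self (n : ℕ) : Nat.primeCounting n ≤ n := by
  rw [← Nat.primesLE_card_eq_primeCounting, Nat.primesLE_eq_filter_Icc_one]
  exact (Finset.card_filter_le _ _).trans (by simp)

theorem not_hasDensity_of_frequently {h : ℝ → ℝ} {S : Set ℕ} {a b : ℝ} (hab : a < b)
    (ha : ∃ᶠ x in atTop, ratio h S x ≤ a) (hb : ∃ᶠ x in atTop, b ≤ ratio h S x) :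
    ¬ HasDensity h S := by
  have h1 : lowerDensity h S ≤ a :=
    liminf_le_of_frequently_le' (ha.mono fun x hx => EReal.coe_le_coe_iff.2 hx)
  have h2 : (b : EReal) ≤ upperDensity h S :=
    le_limsup_of_frequently_le' (hb.mono fun x hx => EReal.coe_le_coe_iff.2 hx)
  exact ((h1.trans_lt (EReal.coe_lt_coe_iff.2 hab)).trans_le h2).ne

/-- The gap between `s (2 * n - 1)` and `s (2 * n)` contributes nothing. -/
theorem countUpTo_alternatingPrimes_le {s : ℕ → ℕ} (hs : StrictMono s) (n : ℕ) :
    countUpTo (alternatingPrimes s) (s (2 * n)) ≤ s (2 * n - 1) := by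
  rw [countUpTo, show s (2 * n - 1) = (Set.Iio (s (2 * n - 1))).ncard by simp [← Finset.coe_Iio]]
  refine Set.ncard_le_ncard ?_ (Set.finite_Iio _)
  rintro p ⟨⟨-, k, -, hk, hk'⟩, hp⟩
  have := hs.lt_iff_lt.1 (hk.trans_le hp)
  exact hk'.trans_le (hs.monotone (by omega))

theorem primeCounting_le_countUpTo_alternatingPrimes_add {s : ℕ → ℕ} {n : ℕ} (hn : 1 ≤ n)
    (hprime : ¬ (s (2 * n + 1)).Prime) :
    Nat.primeCounting (s (2 * n + 1)) ≤
      countUpTo (alternatingPrimes s) (s (2 * n + 1)) + s (2 * n) := by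
  set x := s (2 * n + 1)
  have h1 : Nat.primeCounting x = {p | p.Prime ∧ p ≤ x}.ncard := by
    rw [← Nat.primesLE_card_eq_primeCounting, ← Set.ncard_coe_finset]
    congr 1
    ext p
    simp [Nat.mem_primesLE, and_comm]
  have h2 : s (2 * n) = (Set.Icc 1 (s (2 * n))).ncard := by simp [← Finset.coe_Icc]
  rw [h1, h2]
  refine (Set.ncard_le_ncard ?_ ?_).trans (Set.ncard_union_le _ _)
  · rintro p ⟨hp, hpx⟩
    rcases le_or_gt p (s (2 * n)) with h | h
    · exact .inr ⟨hp.one_le, h⟩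
    · exact .inl ⟨⟨hp, n, hn, h, hpx.lt_of_ne fun e => hprime (e ▸ hp)⟩, hpx⟩
  · exact ((Set.finite_Iic x).subset fun p hp => hp.2).union (Set.finite_Icc _ _)

theorem strictMono_pow_pow {q : ℕ} (hq : 1 < q) : StrictMono fun n : ℕ => q ^ q ^ n :=
  (pow_right_strictMono₀ hq).comp (pow_right_strictMono₀ hq)

theorem log_pow_pow (q n : ℕ) : Real.log ((q ^ q ^ n : ℕ) : ℝ) = q ^ n * Real.log q := by
  push_cast
  rw [Real.log_pow]
  push_cast
  rfl

theorem frequently_ratio_le {q : ℕ} (hq : 2 ≤ q) :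
    ∃ᶠ x in atTop, ratio Real.log (alternatingPrimes fun n => q ^ q ^ n) x ≤ 2 / q := by
  have hs := strictMono_pow_pow (q := q) hq
  have htend : Tendsto (fun n => q ^ q ^ (2 * n)) atTop atTop :=
    hs.tendsto_atTop.comp (tendsto_id.const_mul_atTop' two_pos)
  refine htend.frequently (Eventually.frequently ?_)
  filter_upwards [htend.eventually eventually_rpow_half_le_primeCounting, eventually_ge_atTop 1]
    with n hn hn1
  have hqR : (2 : ℝ) ≤ q := by exact_mod_cast hq
  have hlogq : 0 < Real.log q := Real.log_pos (by linarith)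
  have hpow : (0 : ℝ) < ((q ^ q ^ (2 * n) : ℕ) : ℝ) := by positivity
  have hden : 1 / 2 * ((q : ℝ) ^ (2 * n) * Real.log q) ≤
      Real.log (Nat.primeCounting (q ^ q ^ (2 * n))) := by
    rw [← log_pow_pow, ← Real.log_rpow hpow]
    exact Real.log_le_log (by positivity) hn
  have hnum : Real.log (countUpTo (alternatingPrimes fun n => q ^ q ^ n) (q ^ q ^ (2 * n))) ≤
      (q : ℝ) ^ (2 * n - 1) * Real.log q := by
    have h := countUpTo_alternatingPrimes_le hs n
    rw [← log_pow_pow]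
    rcases Nat.eq_zero_or_pos
      (countUpTo (alternatingPrimes fun n => q ^ q ^ n) (q ^ q ^ (2 * n))) with h0 | h0
    -- The convention `Real.log 0 = 0` covers an empty count.
    · rw [h0, Nat.cast_zero, Real.log_zero, log_pow_pow]
      positivity
    · exact Real.log_le_log (by exact_mod_cast h0) (by exact_mod_cast h)
  have hpos : 0 < 1 / 2 * ((q : ℝ) ^ (2 * n) * Real.log q) := by positivity
  rw [ratio, div_le_iff₀ (hpos.trans_le hden)]
  refine hnum.trans ?_
  refine le_trans (le_of_eq ?_) (mul_le_mul_of_nonneg_left hden (by positivity))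
  obtain ⟨k, rfl⟩ : ∃ k, n = k + 1 := ⟨n - 1, by omega⟩
  rw [show 2 * (k + 1) - 1 = 2 * k + 1 by omega]
  field_simp
  ring

theorem frequently_le_ratio {q : ℕ} (hq : 6 ≤ q) :
    ∃ᶠ x in atTop, 1 / 3 ≤ ratio Real.log (alternatingPrimes fun n => q ^ q ^ n) x := by
  have hs := strictMono_pow_pow (q := q) (by omega)
  have htend : Tendsto (fun n => q ^ q ^ (2 * n + 1)) atTop atTop :=
    hs.tendsto_atTop.comp (tendsto_atTop_mono (fun n => show n ≤ 2 * n + 1 by omega) tendsto_id)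
  refine htend.frequently (Eventually.frequently ?_)
  filter_upwards [htend.eventually eventually_rpow_half_le_primeCounting, eventually_ge_atTop 1]
    with n hn hn1
  have hnp : ¬ (q ^ q ^ (2 * n + 1)).Prime :=
    Nat.Prime.not_prime_pow (le_trans (by omega) (Nat.le_self_pow (2 * n).succ_ne_zero q))
  have hle := primeCounting_le_countUpTo_alternatingPrimes_add
    (s := fun n => q ^ q ^ n) hn1 hnp
  have hyx : (q ^ q ^ (2 * n)) ^ 6 ≤ q ^ q ^ (2 * n + 1) := by
    rw [← pow_mul, pow_succ q (2 * n)]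
    exact Nat.pow_le_pow_right (by omega) (Nat.mul_le_mul_left _ hq)
  have hy2 : 2 ≤ q ^ q ^ (2 * n) :=
    le_trans (by omega) (Nat.le_self_pow (pow_pos (by omega) _).ne' q)
  rw [ratio]
  set x := q ^ q ^ (2 * n + 1)
  set y := q ^ q ^ (2 * n)
  set c := countUpTo (alternatingPrimes fun n => q ^ q ^ n) x
  have hx2 : 2 ≤ x := (hy2.trans (Nat.le_self_pow (by norm_num) y)).trans hyx
  have hxR : (2 : ℝ) ≤ x := by exact_mod_cast hx2
  -- In terms of `t`: `y ≤ t` and `π x ≥ t ^ 3`, so `c ≥ t ^ 3 - t ≥ t ^ 2`, while `π x ≤ t ^ 6`;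
  -- the exponents give `2 / 6`.
  set t := (x : ℝ) ^ (1 / 6 : ℝ) with ht
  have ht0 : 0 ≤ t := by positivity
  have ht6 : t ^ 6 = x := by
    rw [ht, ← Real.rpow_mul_natCast (by linarith)]; norm_num
  have ht3 : t ^ 3 = (x : ℝ) ^ (1 / 2 : ℝ) := by
    rw [ht, ← Real.rpow_mul_natCast (by linarith)]; norm_num
  have hyt : (y : ℝ) ≤ t := by
    refine le_of_pow_le_pow_left₀ (n := 6) (by norm_num) ht0 ?_
    rw [ht6]; exact_mod_cast hyx
  have ht2 : 2 ≤ t := le_trans (by exact_mod_cast hy2) hyt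
  have hleR : (Nat.primeCounting x : ℝ) ≤ c + y := by exact_mod_cast hle
  rw [← ht3] at hn
  have hc : t ^ 2 ≤ c := by nlinarith [mul_le_mul_of_nonneg_left ht2 (sq_nonneg t)]
  have hπ1 : 1 < (Nat.primeCounting x : ℝ) := by
    nlinarith [mul_le_mul_of_nonneg_left ht2 (sq_nonneg t)]
  have hπ : (Nat.primeCounting x : ℝ) ≤ x := by exact_mod_cast primeCounting_le_self x
  rw [le_div_iff₀ (Real.log_pos hπ1)]
  have h1 : Real.log (Nat.primeCounting x) ≤ 6 * Real.log t := by
    have : Real.log (t ^ 6) = 6 * Real.log t := by rw [Real.log_pow]; norm_num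
    rw [← this, ht6]
    exact Real.log_le_log (by linarith) hπ
  have h2 : 2 * Real.log t ≤ Real.log c := by
    have : Real.log (t ^ 2) = 2 * Real.log t := by rw [Real.log_pow]; norm_num
    rw [← this]
    exact Real.log_le_log (by positivity) hc
  linarith

theorem not_hasExponentialDensity_alternatingPrimes {q : ℕ} (hq : 7 ≤ q) :
    ¬ HasExponentialDensity (alternatingPrimes fun n => q ^ q ^ n) := by
  have hqR : (7 : ℝ) ≤ q := by exact_mod_cast hq
  refine not_hasDensity_of_frequently (a := 2 / q) (b := 1 / 3) ?_
    (frequently_ratio_le (by omega)) (frequently_le_ratio (by omega))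
  rw [div_lt_div_iff₀ (by linarith) (by norm_num)]
  linarith

end PrimeDensity

theorem mainTheorem3 (q : ℕ) (hq : q.Prime) (hq7 : 7 ≤ q) :
    ∃ θ : RingLogic.Sentence,
      RingLogic.primeSpectrum θ = PrimeDensity.alternatingPrimes (fun n => q ^ q ^ n) ∧
      ¬ PrimeDensity.HasExponentialDensity (RingLogic.primeSpectrum θ) := by
  obtain ⟨θ, hθ⟩ := RingLogic.exists_sentence_primeSpectrum hq
  exact ⟨θ, hθ, hθ ▸ PrimeDensity.not_hasExponentialDensity_alternatingPrimes hq7⟩
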